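/- Let $\mathcal X$ be a finite set, let $n,k,T\ge 1$ be integers, $\rho>0$ and $\alpha\in(0,1)$. A dataset is a tuple $P\in\mathcal X^n$; its normalized frequencies are $P(x)=\frac1n|\{i: P_i=x\}|$. Two datasets in $\mathcal X^n$ are neighboring if they differ in at most one record. Let $Q$ be a finite nonempty set of linear queries $q_\phi(D)=\sum_{x\in\mathcal X}\phi(x)D(x)$ with predicates $\phi:\mathcal X\to\{0,1\}$. Put $$\varepsilon_0=\sqrt{\frac{2\rho}{kT\left(\alpha^2+(1-\alpha)^2\right)}}.$$ The algorithm Adaptive Measurements is given a family $\mathcal D$ of probability distributions on $\mathcal X$, an initial $D_0\in\mathcal D$, loss functions $\mathcal L$ and a measurable function $H$ with values in a measurable space, all chosen independently of the dataset. On input $P$ it performs, for $t=1,\dots,T$, the following steps (with fresh randomness given the past). * Sample: run the exponential mechanism $k$ times independently, that is, draw $\tilde q_{t,1},\dots,\tilde q_{t,k}\in Q$ independently with $\Pr[\tilde q_{t,i}=q]\propto\exp\left(\alpha\varepsilon_0 n\,|q(P)-q(D_{t-1})|\right)$. * Measure: run the Gaussian mechanism $k$ times, that is, put $\tilde a_{t,i}=\tilde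 q_{t,i}(P)+z_{t,i}$ with independent $z_{t,i}\sim\mathcal N\left(0,\left(\frac{1}{n(1-\alpha)\varepsilon_0}\right)^2\right)$ for $i=1,\dots,k$. * Update: let $D_t\in\mathcal D$ be a minimizer over $D\in\mathcal D$ of the loss $\mathcal L$, which may depend on $D_0,\dots,D_{t-1}$ and on all queries and noisy answers of the rounds $1,\dots,t$. The minimizer is chosen by a fixed rule that is measurable in these data; where no minimizer exists, the rule returns some element of $\mathcal D$. It outputs $H(D_0,\dots,D_T)$. Write $\mathcal M(P)$ for the law of the output on input $P$. Then: 1. $\mathcal M$ satisfies $\rho$-zCDP: for all neighboring $P,P'\in\mathcal X^n$ and all $\beta\in(1,\infty)$, the Rényi divergence satisfies $\mathrm D_\beta\left(\mathcal M(P)\,\|\,\mathcal M(P')\right)\le\rho\beta$. 2. For every $\delta>0$, $\mathcal M$ is $\left(\rho+2\sqrt{\rho\log(1/\delta)},\,\delta\right)$-differentially private: with $\varepsilon=\rho+2\sqrt{\rho\log(1/\delta)}$ (the root being read as $0$ if $\delta>1$, where the claim is trivial), $\Pr[\mathcal M(P)\in S]\le e^{\varepsilon}\Pr[\mathcal M(P')\in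 S]+\delta$ for all neighboring $P,P'$ and all measurable sets $S$. -/

import Mathlib

open MeasureTheory ProbabilityTheory

noncomputable section

/-! ### Datasets and privacy notions -/

/-- Two datasets of `n` records are neighboring if they differ in at most one record. -/
def Neighboring {X : Type*} {n : ℕ} (P P' : Fin n → X) : Prop :=
  ∃ i, ∀ j, j ≠ i → P j = P' j

/-- The Rényi divergence of order `a` (for `a > 1`), with value `⊤` if `μ` is not absolutely
continuous with respect to `ν`. -/
def renyiDivergence {R : Type*} [MeasurableSpace R] (a : ℝ) (μ ν : Measure R) : EReal :=
  open Classical in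
  if μ ≪ ν then (((a - 1)⁻¹ : ℝ) : EReal) * ENNReal.log (∫⁻ x, (μ.rnDeriv ν x) ^ a ∂ν) else ⊤

/-- `ρ`-zero-concentrated differential privacy. -/
def IsZCDP {X R : Type*} [MeasurableSpace R] {n : ℕ} (ρ : ℝ)
    (M : (Fin n → X) → ProbabilityMeasure R) : Prop :=
  ∀ P P' : Fin n → X, Neighboring P P' → ∀ a : ℝ, 1 < a →
    renyiDivergence a (M P : Measure R) (M P' : Measure R) ≤ ((ρ * a : ℝ) : EReal)

/-- `(ε, δ)`-differential privacy. -/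
def IsDP {X R : Type*} [MeasurableSpace R] {n : ℕ} (ε δ : ℝ)
    (M : (Fin n → X) → ProbabilityMeasure R) : Prop :=
  ∀ P P' : Fin n → X, Neighboring P P' → ∀ S : Set R, MeasurableSet S →
    (M P : Measure R) S ≤
      ENNReal.ofReal (Real.exp ε) * (M P' : Measure R) S + ENNReal.ofReal δ

/-! ### Linear queries -/

/-- The normalized frequencies of a dataset. -/
def freq {X : Type*} [DecidableEq X] {n : ℕ} (P : Fin n → X) (x : X) : ℝ :=
  ((Finset.univ.filter fun i => P i = x).card : ℝ) / n

/-- The answer `∑ x, φ(x) D(x)` of the linear query with predicate `φ`. -/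
def answer {X : Type*} [Fintype X] (φ : X → Bool) (D : X → ℝ) : ℝ :=
  ∑ x, (if φ x then 1 else 0) * D x

/-! ### The two private primitives -/

section Primitives

variable {X : Type*} [Fintype X] {Q : Finset (X → Bool)}

/-- Exponential mechanism: the law on `Q` in which `q` has probability proportional to
`exp (s * |q(p) - q(D)|)`. -/
def expMech (Q : Finset (X → Bool)) (s : ℝ) (p D : X → ℝ) : Measure Q :=
  (Measure.count : Measure Q).tilted fun q => s * |answer q.1 p - answer q.1 D|

instance [Nonempty Q] (s : ℝ) (p D : X → ℝ) : IsProbabilityMeasure (expMech Q s p D) :=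
  isProbabilityMeasure_tilted (Integrable.of_finite)

lemma expMech_singleton (s : ℝ) (p D : X → ℝ) (q : Q) :
    expMech Q s p D {q} = ENNReal.ofReal (Real.exp (s * |answer q.1 p - answer q.1 D|) /
      ∑ r : Q, Real.exp (s * |answer r.1 p - answer r.1 D|)) := by
  rw [expMech, tilted_apply]
  simp [integral_count]

/-- `k` independent runs of the exponential mechanism, as a kernel in the current distribution. -/
def selectKernel (Q : Finset (X → Bool)) [Nonempty Q] (k : ℕ) (s : ℝ) (p : X → ℝ) :
    Kernel (stdSimplex ℝ X) (Fin k → Q) where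
  toFun D := Measure.pi fun _ => expMech Q s p D.1
  measurable' := by
    refine Measure.measurable_of_measurable_coe _ fun S _ => ?_
    have h : ∀ D : stdSimplex ℝ X, (Measure.pi fun _ : Fin k => expMech Q s p D.1) S =
        ∑ f ∈ S.toFinite.toFinset, ∏ i, expMech Q s p D.1 {f i} := fun D => by
      conv_lhs => rw [← S.toFinite.coe_toFinset]
      rw [← sum_measure_singleton]
      simp [Measure.pi_singleton]
    have hc : ∀ q : Q, Measurable fun D : stdSimplex ℝ X => answer q.1 D.1 := fun q =>
      Finset.measurable_fun_sum _ fun x _ =>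
        ((measurable_pi_apply x).comp measurable_subtype_coe).const_mul _
    have he : ∀ q : Q, Measurable fun D : stdSimplex ℝ X =>
        Real.exp (s * |answer q.1 p - answer q.1 D.1|) := fun q =>
      (((hc q).const_sub _).abs.const_mul _).exp
    simp_rw [h, expMech_singleton]
    exact Finset.measurable_fun_sum _ fun f _ => Finset.measurable_fun_prod _ fun i _ =>
      ((he (f i)).div (Finset.measurable_fun_sum _ fun r _ => he r)).ennreal_ofReal

instance [Nonempty Q] (k : ℕ) (s : ℝ) (p : X → ℝ) : IsMarkovKernel (selectKernel Q k s p) :=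
  ⟨fun D => inferInstanceAs (IsProbabilityMeasure (Measure.pi fun _ => expMech Q s p D.1))⟩

/-- Gaussian mechanism: independent answers `q i (p) + N(0, v)` to the `k` selected queries. -/
def measureKernel (Q : Finset (X → Bool)) (k : ℕ) (v : NNReal) (p : X → ℝ) :
    Kernel (Fin k → Q) (Fin k → ℝ) :=
  Kernel.ofFunOfCountable fun q => Measure.pi fun i => gaussianReal (answer (q i).1 p) v

instance (k : ℕ) (v : NNReal) (p : X → ℝ) : IsMarkovKernel (measureKernel Q k v p) :=
  ⟨fun q => inferInstanceAs
    (IsProbabilityMeasure (Measure.pi fun i => gaussianReal (answer (q i).1 p) v))⟩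

/-- One round: given the current distribution, select `k` queries, then measure them on `p`. -/
def roundKernel (Q : Finset (X → Bool)) [Nonempty Q] (k : ℕ) (s : ℝ) (v : NNReal) (p : X → ℝ) :
    Kernel (stdSimplex ℝ X) ((Fin k → Q) × (Fin k → ℝ)) :=
  selectKernel Q k s p ⊗ₖ Kernel.prodMkLeft (stdSimplex ℝ X) (measureKernel Q k v p)

instance [Nonempty Q] (k : ℕ) (s : ℝ) (v : NNReal) (p : X → ℝ) :
    IsMarkovKernel (roundKernel Q k s v p) := by
  unfold roundKernel; infer_instance

end Primitives

/-! ### The algorithm -/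

/-- The data-independent ingredients of the framework for a query set `Q` with `k` queries per
round: a family of distributions, an initial member of it, loss functions and an update rule.
In round `t + 1` the loss of a candidate may depend on the iterates `D 0, …, D t` and on all
queries and noisy answers of the rounds `1, …, t + 1`. The update is a member of the family which
minimizes the loss over the family whenever a minimizer exists. -/
structure AdaptiveMeasurements (X : Type*) [Fintype X] (Q : Finset (X → Bool)) (k : ℕ) where
  family : Set (stdSimplex ℝ X)
  init : stdSimplex ℝ X
  init_mem : init ∈ family
  loss : (t : ℕ) → (Fin (t + 1) → stdSimplex ℝ X) → (Fin (t + 1) → Fin k → Q) →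
    (Fin (t + 1) → Fin k → ℝ) → stdSimplex ℝ X → ℝ
  update : (t : ℕ) → (Fin (t + 1) → stdSimplex ℝ X) → (Fin (t + 1) → Fin k → Q) →
    (Fin (t + 1) → Fin k → ℝ) → stdSimplex ℝ X
  update_mem : ∀ t D q a, update t D q a ∈ family
  update_argmin : ∀ t D q a, (∃ D' ∈ family, IsMinOn (loss t D q a) family D') →
    IsMinOn (loss t D q a) family (update t D q a)
  measurable_update : ∀ t, Measurable fun h : (Fin (t + 1) → stdSimplex ℝ X) ×
    (Fin (t + 1) → Fin k → Q) × (Fin (t + 1) → Fin k → ℝ) => update t h.1 h.2.1 h.2.2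

lemma measurable_snoc {α E : Type*} [MeasurableSpace α] [MeasurableSpace E] {t : ℕ}
    {f : α → Fin t → E} {g : α → E} (hf : Measurable f) (hg : Measurable g) :
    Measurable fun x => (Fin.snoc (f x) (g x) : Fin (t + 1) → E) := by
  refine measurable_pi_lambda _ fun i => ?_
  refine Fin.lastCases ?_ (fun j => ?_) i
  · simpa using hg
  · simpa [Function.comp_def] using (measurable_pi_apply j).comp hf

namespace AdaptiveMeasurements

variable {X : Type*} [Fintype X] {Q : Finset (X → Bool)} {k : ℕ}

/-- The state after `t` rounds: the iterates `D 0, …, D t`, and the selected queries and the noisy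
answers of the rounds `1, …, t`. -/
abbrev State (X : Type*) [Fintype X] (Q : Finset (X → Bool)) (k t : ℕ) : Type _ :=
  (Fin (t + 1) → stdSimplex ℝ X) × (Fin t → Fin k → Q) × (Fin t → Fin k → ℝ)

/-- Append the queries and answers of a round to the state, together with the updated iterate. -/
def extend (A : AdaptiveMeasurements X Q k) (t : ℕ)
    (s : State X Q k t × ((Fin k → Q) × (Fin k → ℝ))) : State X Q k (t + 1) :=
  let q : Fin (t + 1) → Fin k → Q := Fin.snoc s.1.2.1 s.2.1
  let a : Fin (t + 1) → Fin k → ℝ := Fin.snoc s.1.2.2 s.2.2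
  (Fin.snoc s.1.1 (A.update t s.1.1 q a), q, a)

lemma measurable_extend (A : AdaptiveMeasurements X Q k) (t : ℕ) : Measurable (A.extend t) := by
  have hq : Measurable fun s : State X Q k t × ((Fin k → Q) × (Fin k → ℝ)) =>
      (Fin.snoc s.1.2.1 s.2.1 : Fin (t + 1) → Fin k → Q) :=
    measurable_snoc (by fun_prop) (by fun_prop)
  have ha : Measurable fun s : State X Q k t × ((Fin k → Q) × (Fin k → ℝ)) =>
      (Fin.snoc s.1.2.2 s.2.2 : Fin (t + 1) → Fin k → ℝ) :=
    measurable_snoc (by fun_prop) (by fun_prop)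
  have hD : Measurable fun s : State X Q k t × ((Fin k → Q) × (Fin k → ℝ)) => s.1.1 := by
    fun_prop
  exact (measurable_snoc hD
    ((A.measurable_update t).comp (hD.prodMk (hq.prodMk ha)))).prodMk (hq.prodMk ha)

/-- The law of the state after `t` rounds, where `p` holds the true frequencies, `s` is the
coefficient of the exponential mechanism and `v` the variance of the Gaussian noise. Round `t + 1`
runs at the last iterate `D t`. -/
def stateLaw (A : AdaptiveMeasurements X Q k) [Nonempty Q] (s : ℝ) (v : NNReal) (p : X → ℝ) :
    (t : ℕ) → Measure (State X Q k t)
  | 0 => Measure.dirac (fun _ => A.init, Fin.elim0, Fin.elim0)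
  | t + 1 => ((A.stateLaw s v p t) ⊗ₘ ((roundKernel Q k s v p).comap
      (fun h : State X Q k t => h.1 (Fin.last t)) (by fun_prop))).map (A.extend t)

instance (A : AdaptiveMeasurements X Q k) [Nonempty Q] (s : ℝ) (v : NNReal) (p : X → ℝ) (t : ℕ) :
    IsProbabilityMeasure (A.stateLaw s v p t) := by
  induction t with
  | zero => rw [stateLaw]; infer_instance
  | succ t ih =>
    rw [stateLaw]
    exact Measure.isProbabilityMeasure_map (A.measurable_extend t).aemeasurable

/-- The per-mechanism parameter `ε₀` for total budget `ρ`, `T` rounds, `k` queries per round and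
privacy allocation `α`. -/
def eps0 (ρ : ℝ) (T k : ℕ) (α : ℝ) : ℝ :=
  √(2 * ρ / (k * T * (α ^ 2 + (1 - α) ^ 2)))

/-- The algorithm run for `T` rounds with privacy parameter `ρ` and allocation `α`, as a map
from datasets of `n` records to the law of the output `H (D 0, …, D T)`. -/
def mechanism [DecidableEq X] [Nonempty Q] {R : Type*} [MeasurableSpace R]
    (A : AdaptiveMeasurements X Q k) (n T : ℕ) (ρ α : ℝ)
    (H : (Fin (T + 1) → stdSimplex ℝ X) → R) (hH : Measurable H) (P : Fin n → X) :
    ProbabilityMeasure R :=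
  ⟨(A.stateLaw (α * eps0 ρ T k α * n)
      (Real.toNNReal ((1 / (n * (1 - α) * eps0 ρ T k α)) ^ 2)) (freq P) T).map
      fun h => H h.1,
    Measure.isProbabilityMeasure_map (hH.comp measurable_fst).aemeasurable⟩

end AdaptiveMeasurements

end

open scoped ENNReal NNReal

/-! Rényi divergence of order `a` is the log of the `a`-th moment of the density, and these moments
multiply under independent products (`pi`) and adaptive composition (`measure_compProd`), and do not
increase under maps (`map`). So each primitive is bounded separately and the exponents add up.

Linear queries have sensitivity `1/n`. Changing the dataset tilts the exponential mechanism by a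
function with values in an interval of length `2αε₀`; a Hoeffding argument (`tilted_of_abs_le`)
gives exponent `a(a-1)(αε₀)²/2`. Gaussian noise gives `a(a-1)((1-α)ε₀)²/2` by direct computation.
Summed over `kT` runs, the choice of `ε₀` makes this `(a-1)ρa`. Updates and `H` are post-processing.
Part 2 is Markov's inequality for the privacy loss at the optimal order. -/

/-- `μ` has a density `f` with respect to `ν` whose `a`-th moment is at most `c`. -/
def HasRenyiBound {Ω : Type*} [MeasurableSpace Ω] (a : ℝ) (c : ℝ≥0∞) (μ ν : Measure Ω) : Prop :=
  ∃ f : Ω → ℝ≥0∞, Measurable f ∧ μ = ν.withDensity f ∧ ∫⁻ x, f x ^ a ∂ν ≤ c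

/-! ### Data processing and independent products -/

namespace HasRenyiBound

variable {Ω Ω' : Type*} [MeasurableSpace Ω] [MeasurableSpace Ω'] {a : ℝ} {c : ℝ≥0∞}
  {μ ν : Measure Ω}

lemma refl (a : ℝ) (μ : Measure Ω) [IsProbabilityMeasure μ] : HasRenyiBound a 1 μ μ :=
  ⟨1, measurable_one, by simp, by simp⟩

lemma absolutelyContinuous (h : HasRenyiBound a c μ ν) : μ ≪ ν := by
  obtain ⟨f, -, rfl, -⟩ := h
  exact withDensity_absolutelyContinuous ν f

lemma lintegral_rnDeriv_rpow_le [SigmaFinite ν] (h : HasRenyiBound a c μ ν) :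
    ∫⁻ x, μ.rnDeriv ν x ^ a ∂ν ≤ c := by
  obtain ⟨f, hf, rfl, hc⟩ := h
  refine le_trans (lintegral_mono_ae ?_) hc
  filter_upwards [Measure.rnDeriv_withDensity ν hf] with x hx
  rw [hx]

lemma mono (h : HasRenyiBound a c μ ν) {c' : ℝ≥0∞} (hc : c ≤ c') : HasRenyiBound a c' μ ν := by
  obtain ⟨f, hf, hμ, h⟩ := h
  exact ⟨f, hf, hμ, h.trans hc⟩

/-- Cancellation in the inequality that Hölder's inequality gives for conjugate exponents. -/
lemma le_of_le_rpow_mul_rpow {p q : ℝ} (hpq : p.HolderConjugate q) {x y : ℝ≥0∞} (hx : x ≠ ∞)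
    (h : x ≤ y ^ (1 / p) * x ^ (1 / q)) : x ≤ y := by
  rcases eq_or_ne x 0 with rfl | h0
  · exact zero_le
  have hx' : x = x ^ (1 / p) * x ^ (1 / q) := by
    rw [← ENNReal.rpow_add _ _ h0 hx, one_div, one_div, hpq.inv_add_inv_eq_one, ENNReal.rpow_one]
  have hq0 : x ^ (1 / q) ≠ 0 := by
    simp [ENNReal.rpow_eq_zero_iff, h0, hx]
  have hqt : x ^ (1 / q) ≠ ∞ := ENNReal.rpow_ne_top_of_nonneg (by
    have := hpq.symm.pos; positivity) hx
  have h' : x ^ (1 / p) * x ^ (1 / q) ≤ y ^ (1 / p) * x ^ (1 / q) := hx'.symm.trans_le h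
  exact (ENNReal.rpow_le_rpow_iff (one_div_pos.2 hpq.pos)).1
    ((ENNReal.mul_le_mul_iff_left hq0 hqt).1 h')

/-- Data processing: the moment bound is preserved by measurable maps. -/
lemma map (ha : 1 < a) [IsFiniteMeasure μ] [IsFiniteMeasure ν] (h : HasRenyiBound a c μ ν)
    {g : Ω → Ω'} (hg : Measurable g) : HasRenyiBound a c (μ.map g) (ν.map g) := by
  have hac : μ.map g ≪ ν.map g := h.absolutelyContinuous.map hg
  obtain ⟨f, hf, hμ, hc⟩ := h
  set r := (μ.map g).rnDeriv (ν.map g)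
  have hr : Measurable r := Measure.measurable_rnDeriv _ _
  have hwd : μ.map g = (ν.map g).withDensity r := (Measure.withDensity_rnDeriv_eq _ _ hac).symm
  have ha0 : 0 < a := by linarith
  have hpq : a.HolderConjugate (Real.conjExponent a) := Real.HolderConjugate.conjExponent ha
  refine ⟨r, hr, hwd, ?_⟩
  -- Hölder bounds the moment by a power of itself, and cancelling requires finiteness; hence the
  -- truncation at `N`, removed by monotone convergence.
  have hN : ∀ N : ℕ, ∫⁻ y, min (r y) N ^ a ∂(ν.map g) ≤ c := by
    intro N
    have hm : Measurable fun y => min (r y) (N : ℝ≥0∞) := hr.min measurable_const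
    refine le_trans (le_of_le_rpow_mul_rpow hpq ?_ ?_) hc
    · refine ne_top_of_le_ne_top ?_ (lintegral_mono fun y =>
        ENNReal.rpow_le_rpow (min_le_right (r y) (N : ℝ≥0∞)) ha0.le)
      rw [lintegral_const]
      exact ENNReal.mul_ne_top (ENNReal.rpow_ne_top_of_nonneg ha0.le (by simp))
        (measure_ne_top _ _)
    · calc ∫⁻ y, min (r y) N ^ a ∂(ν.map g)
          ≤ ∫⁻ y, r y * min (r y) N ^ (a - 1) ∂(ν.map g) := by
            refine lintegral_mono fun y => ?_
            have : a = 1 + (a - 1) := by ring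
            conv_lhs => rw [this, ENNReal.rpow_add_of_nonneg _ _ zero_le_one (by linarith),
              ENNReal.rpow_one]
            gcongr
            exact min_le_left _ _
        _ = ∫⁻ y, min (r y) N ^ (a - 1) ∂(μ.map g) := by
            rw [hwd, lintegral_withDensity_eq_lintegral_mul _ hr (hm.pow_const _)]
            rfl
        _ = ∫⁻ x, f x * min (r (g x)) N ^ (a - 1) ∂ν := by
            rw [lintegral_map (hm.pow_const _) hg, hμ]
            exact lintegral_withDensity_eq_lintegral_mul ν hf ((hm.comp hg).pow_const _)
        _ ≤ _ := by
            -- The conjugate exponent of `a` is `a / (a - 1)`, so the second factor is a power of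
            -- the integral being bounded.
            refine (ENNReal.lintegral_mul_le_Lp_mul_Lq ν hpq hf.aemeasurable
              ((hm.comp hg).pow_const (a - 1)).aemeasurable).trans_eq ?_
            rw [lintegral_map (hm.pow_const _) hg]
            congr 3 with x
            rw [← ENNReal.rpow_mul, Real.conjExponent, mul_div_cancel₀ _ (by linarith)]
            rfl
  have hlim := lintegral_tendsto_of_tendsto_of_monotone (μ := ν.map g)
    (f := fun (N : ℕ) y => min (r y) N ^ a) (F := fun y => r y ^ a)
    (fun N => ((hr.min measurable_const).pow_const _).aemeasurable)
    (.of_forall fun y N M hNM => by dsimp only; gcongr)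
    (.of_forall fun y => by
      have : Filter.Tendsto (fun N : ℕ => min (r y) (N : ℝ≥0∞)) Filter.atTop (nhds (r y)) := by
        simpa using (tendsto_const_nhds (x := r y)).min ENNReal.tendsto_nat_nhds_top
      exact (ENNReal.continuous_rpow_const.tendsto _).comp this)
  exact le_of_tendsto' hlim hN

lemma lintegral_pi_prod {ι : Type*} [Fintype ι] {E : ι → Type*} [∀ i, MeasurableSpace (E i)]
    (μ : ∀ i, Measure (E i)) [∀ i, IsProbabilityMeasure (μ i)] {f : ∀ i, E i → ℝ≥0∞}
    (hf : ∀ i, Measurable (f i)) :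
    ∫⁻ x, ∏ i, f i (x i) ∂(Measure.pi μ) = ∏ i, ∫⁻ x, f i x ∂(μ i) := by
  have hi := iIndepFun_pi (μ := μ) (X := f) fun i => (hf i).aemeasurable
  have := lintegral_prod_eq_prod_lintegral_of_indepFun Finset.univ
    (fun i (x : ∀ i, E i) => f i (x i)) hi fun i => (hf i).comp (measurable_pi_apply i)
  rw [this]
  refine Finset.prod_congr rfl fun i _ => ?_
  rw [← (measurePreserving_eval μ i).lintegral_comp (hf i)]

/-- The product of the densities is a density, as boxes determine a product measure; its moment
factors by independence. -/
lemma pi {ι : Type*} [Fintype ι] {E : ι → Type*} [∀ i, MeasurableSpace (E i)] (ha : 0 ≤ a)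
    {c : ι → ℝ≥0∞} {μ ν : ∀ i, Measure (E i)} [∀ i, IsProbabilityMeasure (μ i)]
    [∀ i, IsProbabilityMeasure (ν i)] (h : ∀ i, HasRenyiBound a (c i) (μ i) (ν i)) :
    HasRenyiBound a (∏ i, c i) (Measure.pi μ) (Measure.pi ν) := by
  choose f hf hμ hc using h
  refine ⟨fun x => ∏ i, f i (x i), by fun_prop, ?_, ?_⟩
  · refine Measure.pi_eq (μ := μ) fun s hs => ?_
    rw [withDensity_apply _ (.univ_pi hs), ← lintegral_indicator (.univ_pi hs)]
    have : (fun x => (Set.univ.pi s).indicator (fun x => ∏ i, f i (x i)) x) =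
        fun x => ∏ i, (s i).indicator (f i) (x i) := by
      ext x
      classical
      simp only [Set.indicator_apply, Set.mem_univ_pi]
      split_ifs with hx
      · exact Finset.prod_congr rfl fun i _ => by simp [hx i]
      · push Not at hx
        obtain ⟨i, hi⟩ := hx
        exact (Finset.prod_eq_zero (Finset.mem_univ i) (by simp [hi])).symm
    rw [this, lintegral_pi_prod ν fun i => (hf i).indicator (hs i)]
    refine Finset.prod_congr rfl fun i _ => ?_
    rw [lintegral_indicator (hs i), hμ i, withDensity_apply _ (hs i)]
  · simp_rw [← ENNReal.prod_rpow_of_nonneg ha]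
    rw [lintegral_pi_prod ν fun i => (hf i).pow_const a]
    exact Finset.prod_le_prod' fun i _ => hc i

end HasRenyiBound

/-! ### From moments to Rényi divergence and approximate privacy -/

namespace HasRenyiBound

variable {Ω Ω' : Type*} [MeasurableSpace Ω] [MeasurableSpace Ω'] {a : ℝ} {c : ℝ≥0∞}
  {μ ν : Measure Ω}

lemma renyiDivergence_le (ha : 1 < a) [SigmaFinite ν] {ρ : ℝ}
    (h : HasRenyiBound a (ENNReal.ofReal (Real.exp ((a - 1) * (ρ * a)))) μ ν) :
    renyiDivergence a μ ν ≤ ((ρ * a : ℝ) : EReal) := by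
  have ha' : 0 < a - 1 := by linarith
  rw [renyiDivergence, if_pos h.absolutelyContinuous]
  have hlog := ENNReal.log_le_log h.lintegral_rnDeriv_rpow_le
  rw [ENNReal.log_ofReal_of_pos (Real.exp_pos _), Real.log_exp] at hlog
  calc _ ≤ (((a - 1)⁻¹ : ℝ) : EReal) * (((a - 1) * (ρ * a) : ℝ) : EReal) := by
        refine mul_le_mul_of_nonneg_left hlog ?_
        exact_mod_cast (inv_pos.2 ha').le
    _ = _ := by
        rw [← EReal.coe_mul, inv_mul_cancel_left₀ ha'.ne']

/-- The tail of the privacy loss is controlled by a moment of the density. -/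
lemma measure_le_exp_mul_add (ha : 1 < a) {ε b : ℝ}
    (h : HasRenyiBound a (ENNReal.ofReal (Real.exp b)) μ ν) {S : Set Ω} (hS : MeasurableSet S) :
    μ S ≤ ENNReal.ofReal (Real.exp ε) * ν S + ENNReal.ofReal (Real.exp (b - (a - 1) * ε)) := by
  obtain ⟨f, hf, rfl, hc⟩ := h
  have ha' : 0 ≤ a - 1 := by linarith
  set e := ENNReal.ofReal (Real.exp ε) with he
  have he0 : e ≠ 0 := by simp [he, Real.exp_pos]
  have het : e ≠ ∞ := ENNReal.ofReal_ne_top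
  have hep : e ^ (a - 1) = ENNReal.ofReal (Real.exp ((a - 1) * ε)) := by
    rw [he, ENNReal.ofReal_rpow_of_pos (Real.exp_pos _), ← Real.exp_mul, mul_comm]
  -- Where `f ≥ e`, one has `f = f ^ a / f ^ (a - 1) ≤ f ^ a / e ^ (a - 1)`.
  have key : ∀ x, f x ≤ e + (e ^ (a - 1))⁻¹ * f x ^ a := by
    intro x
    rcases le_total (f x) e with h | h
    · exact h.trans le_self_add
    · refine le_trans ?_ le_add_self
      have : a = (a - 1) + 1 := by ring
      conv_rhs => rw [this, ENNReal.rpow_add_of_nonneg _ _ ha' zero_le_one, ENNReal.rpow_one,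
        ← mul_assoc]
      refine le_mul_of_one_le_left zero_le ?_
      rw [add_sub_cancel_right]
      calc 1 = (e ^ (a - 1))⁻¹ * e ^ (a - 1) := by
            rw [ENNReal.inv_mul_cancel] <;> rw [hep] <;> simp [Real.exp_pos]
        _ ≤ _ := by gcongr
  rw [withDensity_apply _ hS]
  calc ∫⁻ x in S, f x ∂ν ≤ ∫⁻ x in S, (e + (e ^ (a - 1))⁻¹ * f x ^ a) ∂ν := lintegral_mono key
    _ = e * ν S + (e ^ (a - 1))⁻¹ * ∫⁻ x in S, f x ^ a ∂ν := by
        rw [lintegral_add_left measurable_const, lintegral_const_mul _ (hf.pow_const a)]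
        simp
    _ ≤ e * ν S + (e ^ (a - 1))⁻¹ * ENNReal.ofReal (Real.exp b) := by
        gcongr
        exact (setLIntegral_le_lintegral _ _).trans hc
    _ = _ := by
        rw [hep, ← ENNReal.ofReal_inv_of_pos (Real.exp_pos _), ← Real.exp_neg,
          ← ENNReal.ofReal_mul (Real.exp_pos _).le, ← Real.exp_add]
        ring_nf

end HasRenyiBound

/-- Conversion of Rényi bounds of all orders into an approximate differential privacy guarantee. -/
lemma measure_le_of_forall_hasRenyiBound {Ω : Type*} [MeasurableSpace Ω] {μ ν : Measure Ω}
    [IsProbabilityMeasure μ] {ρ δ : ℝ} (hρ : 0 < ρ) (hδ : 0 < δ)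
    (h : ∀ a : ℝ, 1 < a →
      HasRenyiBound a (ENNReal.ofReal (Real.exp ((a - 1) * (ρ * a)))) μ ν)
    {S : Set Ω} (hS : MeasurableSet S) :
    μ S ≤ ENNReal.ofReal (Real.exp (ρ + 2 * √(ρ * Real.log (1 / δ)))) * ν S +
      ENNReal.ofReal δ := by
  rcases le_or_gt 1 δ with h1 | h1
  · exact prob_le_one.trans ((ENNReal.one_le_ofReal.2 h1).trans le_add_self)
  set l := Real.log (1 / δ) with hl
  have hl0 : 0 < l := Real.log_pos (by rw [lt_div_iff₀ hδ]; linarith)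
  set s := √(ρ * l) with hs
  have hs0 : 0 < s := Real.sqrt_pos.2 (by positivity)
  have hs2 : s * s = ρ * l := Real.mul_self_sqrt (by positivity)
  -- With `u = a - 1` the exponent of the error term is `ρu² - 2su`, minimal at `u = s/ρ` with value
  -- `-s²/ρ = -l`.
  have ha : 1 < 1 + s / ρ := by simp; positivity
  refine ((h _ ha).measure_le_exp_mul_add ha (ε := ρ + 2 * s) hS).trans_eq ?_
  congr 2
  have : (1 + s / ρ - 1) * (ρ * (1 + s / ρ)) - (1 + s / ρ - 1) * (ρ + 2 * s) = - l := by
    field_simp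
    linarith
  rw [this, hl, one_div, Real.log_inv, neg_neg, Real.exp_log hδ]

/-! ### Adaptive composition of kernels -/

namespace ProbabilityTheory.Kernel

variable {Ω₀ Ω₁ Ω₂ : Type*} [MeasurableSpace Ω₀] [MeasurableSpace Ω₁] [MeasurableSpace Ω₂]
  {a : ℝ} {c d : ℝ≥0∞}

/-- The kernel `κ` has a jointly measurable density with respect to `η` whose `a`-th moments are
at most `c`. -/
def HasRenyiBound (a : ℝ) (c : ℝ≥0∞) (κ η : Kernel Ω₀ Ω₁) : Prop :=
  ∃ g : Ω₀ → Ω₁ → ℝ≥0∞, Measurable (Function.uncurry g) ∧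
    ∀ x, κ x = (η x).withDensity (g x) ∧ ∫⁻ y, g x y ^ a ∂(η x) ≤ c

namespace HasRenyiBound

lemma of_countable_left [Countable Ω₀] [MeasurableSingletonClass Ω₀] {κ η : Kernel Ω₀ Ω₁}
    (h : ∀ x, _root_.HasRenyiBound a c (κ x) (η x)) : HasRenyiBound a c κ η := by
  choose g hg hκ hc using h
  exact ⟨g, measurable_from_prod_countable_right hg, fun x => ⟨hκ x, hc x⟩⟩

/-- Densities chosen separately for each `x` need not be jointly measurable; quotients of point
masses are, and they agree with them off null atoms. -/
lemma of_countable_right [Countable Ω₁] [MeasurableSingletonClass Ω₁] {κ η : Kernel Ω₀ Ω₁}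
    [IsFiniteKernel η] (h : ∀ x, _root_.HasRenyiBound a c (κ x) (η x)) :
    HasRenyiBound a c κ η := by
  refine ⟨fun x y => κ x {y} / η x {y}, measurable_from_prod_countable_left fun y =>
    (κ.measurable_coe (measurableSet_singleton y)).div
      (η.measurable_coe (measurableSet_singleton y)), fun x => ?_⟩
  obtain ⟨f, hf, hκ, hc⟩ := h x
  have hae : (fun y => κ x {y} / η x {y}) =ᵐ[η x] f := by
    rw [Filter.EventuallyEq, ae_iff_of_countable]
    intro y hy
    rw [hκ, withDensity_apply _ (measurableSet_singleton y), lintegral_singleton,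
      ENNReal.mul_div_cancel_right hy (measure_ne_top _ _)]
  refine ⟨hκ.trans (MeasureTheory.withDensity_congr_ae hae.symm),
    le_trans (lintegral_mono_ae ?_) hc⟩
  filter_upwards [hae] with y hy
  exact (congrArg (· ^ a) hy).le

lemma comap {κ η : Kernel Ω₁ Ω₂} (h : HasRenyiBound a c κ η) {f : Ω₀ → Ω₁} (hf : Measurable f) :
    HasRenyiBound a c (κ.comap f hf) (η.comap f hf) := by
  obtain ⟨g, hg, h⟩ := h
  exact ⟨fun x => g (f x), hg.comp (hf.prodMap measurable_id), fun x => h (f x)⟩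

lemma withDensity_compProd_eq {μ ν : Measure Ω₁} [SFinite μ] [SFinite ν] {κ η : Kernel Ω₁ Ω₂}
    [IsSFiniteKernel κ] [IsSFiniteKernel η] {f : Ω₁ → ℝ≥0∞} {g : Ω₁ → Ω₂ → ℝ≥0∞}
    (hf : Measurable f) (hg : Measurable (Function.uncurry g)) (hμ : μ = ν.withDensity f)
    (hκ : ∀ x, κ x = (η x).withDensity (g x)) :
    μ ⊗ₘ κ = (ν ⊗ₘ η).withDensity fun z => f z.1 * g z.1 z.2 := by
  have hm : Measurable fun z : Ω₁ × Ω₂ => f z.1 * g z.1 z.2 :=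
    (hf.comp measurable_fst).mul hg
  ext s hs
  rw [Measure.compProd_apply hs, withDensity_apply _ hs, ← lintegral_indicator hs,
    Measure.lintegral_compProd (hm.indicator hs), hμ,
    lintegral_withDensity_eq_lintegral_mul _ hf (measurable_kernel_prodMk_left hs)]
  refine lintegral_congr fun x => ?_
  have hs' := measurable_prodMk_left (x := x) hs
  rw [Pi.mul_apply, hκ, withDensity_apply _ hs', ← lintegral_indicator hs',
    ← lintegral_const_mul _ (hg.of_uncurry_left.indicator hs')]
  refine lintegral_congr fun y => ?_
  by_cases hy : (x, y) ∈ s <;> simp [Set.indicator, hy]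

/-- The second-stage bound is uniform in `x`, so it comes out of the outer integral; this is what
permits adaptivity. -/
lemma lintegral_compProd_rpow_le (ha : 0 ≤ a) {ν : Measure Ω₁} [SFinite ν] {η : Kernel Ω₁ Ω₂}
    [IsSFiniteKernel η] {f : Ω₁ → ℝ≥0∞} {g : Ω₁ → Ω₂ → ℝ≥0∞}
    (hf : Measurable f) (hg : Measurable (Function.uncurry g)) (hc : ∫⁻ x, f x ^ a ∂ν ≤ c)
    (hd : ∀ x, ∫⁻ y, g x y ^ a ∂(η x) ≤ d) :
    ∫⁻ z, (f z.1 * g z.1 z.2) ^ a ∂(ν ⊗ₘ η) ≤ c * d := by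
  have hm : Measurable fun z : Ω₁ × Ω₂ => f z.1 * g z.1 z.2 :=
    (hf.comp measurable_fst).mul hg
  rw [Measure.lintegral_compProd (hm.pow_const a)]
  calc _ ≤ ∫⁻ x, f x ^ a * d ∂ν := by
        refine lintegral_mono fun x => ?_
        simp_rw [ENNReal.mul_rpow_of_nonneg _ _ ha]
        rw [lintegral_const_mul _ (hg.of_uncurry_left.pow_const a)]
        gcongr
        exact hd x
    _ = (∫⁻ x, f x ^ a ∂ν) * d := lintegral_mul_const _ (hf.pow_const a)
    _ ≤ _ := by gcongr

lemma measure_compProd (ha : 0 ≤ a) {μ ν : Measure Ω₁} [SFinite μ] [SFinite ν]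
    {κ η : Kernel Ω₁ Ω₂} [IsSFiniteKernel κ] [IsSFiniteKernel η]
    (hκ : HasRenyiBound a d κ η) (hμ : _root_.HasRenyiBound a c μ ν) :
    _root_.HasRenyiBound a (c * d) (μ ⊗ₘ κ) (ν ⊗ₘ η) := by
  obtain ⟨f, hf, hμ, hc⟩ := hμ
  obtain ⟨g, hg, h⟩ := hκ
  exact ⟨_, (hf.comp measurable_fst).mul hg,
    withDensity_compProd_eq hf hg hμ fun x => (h x).1,
    lintegral_compProd_rpow_le ha hf hg hc fun x => (h x).2⟩

lemma compProd_prodMkLeft (ha : 0 ≤ a) {κ₁ η₁ : Kernel Ω₀ Ω₁} {κ₂ η₂ : Kernel Ω₁ Ω₂}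
    [IsSFiniteKernel κ₁] [IsSFiniteKernel η₁] [IsSFiniteKernel κ₂] [IsSFiniteKernel η₂]
    (h₁ : HasRenyiBound a c κ₁ η₁) (h₂ : HasRenyiBound a d κ₂ η₂) :
    HasRenyiBound a (c * d) (κ₁ ⊗ₖ prodMkLeft Ω₀ κ₂) (η₁ ⊗ₖ prodMkLeft Ω₀ η₂) := by
  have hcp : ∀ (κ : Kernel Ω₀ Ω₁) (η : Kernel Ω₁ Ω₂) [IsSFiniteKernel κ] [IsSFiniteKernel η]
      (x : Ω₀), (κ ⊗ₖ prodMkLeft Ω₀ η) x = κ x ⊗ₘ η := fun κ η _ _ x => by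
    rw [compProd_apply_eq_compProd_sectR]
    rfl
  obtain ⟨f, hf, h₁⟩ := h₁
  obtain ⟨g, hg, h₂⟩ := h₂
  have hf' : ∀ x, Measurable (f x) := fun x => hf.comp measurable_prodMk_left
  refine ⟨fun x z => f x z.1 * g z.1 z.2,
    (hf.comp (measurable_fst.prodMk (measurable_fst.comp measurable_snd))).mul
      (hg.comp measurable_snd), fun x => ?_⟩
  rw [hcp, hcp]
  exact ⟨withDensity_compProd_eq (hf' x) hg (h₁ x).1 fun y => (h₂ y).1,
    lintegral_compProd_rpow_le ha (hf' x) hg (h₁ x).2 fun y => (h₂ y).2⟩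

end HasRenyiBound

end ProbabilityTheory.Kernel

/-! ### Exponential tilts and Gaussian measures -/

namespace HasRenyiBound

variable {Ω : Type*} [MeasurableSpace Ω] {a : ℝ} {μ : Measure Ω}

/-- The moments of the density of an exponential tilt, in terms of the cumulants. -/
lemma tilted_of_cgf_le [IsProbabilityMeasure μ] {h : Ω → ℝ} (hm : Measurable h) {b : ℝ}
    (h1 : Integrable (fun x => Real.exp (h x)) μ)
    (hi : Integrable (fun x => Real.exp (a * h x)) μ)
    (hb : cgf h μ a - a * cgf h μ 1 ≤ b) :
    HasRenyiBound a (ENNReal.ofReal (Real.exp b)) (μ.tilted h) μ := by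
  have h1' : Integrable (fun x => Real.exp (1 * h x)) μ := by simpa using h1
  have hz : ∫ x, Real.exp (h x) ∂μ = Real.exp (cgf h μ 1) := by
    rw [exp_cgf h1', mgf]; simp
  refine ⟨fun x => ENNReal.ofReal (Real.exp (h x) / ∫ x, Real.exp (h x) ∂μ), by fun_prop, rfl, ?_⟩
  have : ∀ x, ENNReal.ofReal (Real.exp (h x) / ∫ x, Real.exp (h x) ∂μ) ^ a =
      ENNReal.ofReal (Real.exp (- (a * cgf h μ 1)) * Real.exp (a * h x)) := fun x => by
    rw [hz, ← Real.exp_sub, ENNReal.ofReal_rpow_of_pos (Real.exp_pos _), ← Real.exp_mul,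
      ← Real.exp_add]
    ring_nf
  simp_rw [this]
  rw [← ofReal_integral_eq_lintegral_ofReal (hi.const_mul _) (.of_forall fun x => by positivity),
    integral_const_mul]
  refine ENNReal.ofReal_le_ofReal ?_
  change _ * mgf h μ a ≤ _
  rw [← exp_cgf hi, ← Real.exp_add, Real.exp_le_exp]
  linarith

/-- A tilt by a function with values in an interval of length `2 * b`: the bounded range property
gives the constant of Hoeffding's lemma. -/
lemma tilted_of_abs_le [IsProbabilityMeasure μ] {h : Ω → ℝ} (hm : Measurable h) {b : ℝ}
    (hb : ∀ x, |h x| ≤ b) (ha : 1 < a) :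
    HasRenyiBound a (ENNReal.ofReal (Real.exp (a * (a - 1) * b ^ 2 / 2))) (μ.tilted h) μ := by
  have hIcc : ∀ x, h x ∈ Set.Icc (-b) b := fun x => abs_le.1 (hb x)
  have hi : ∀ t, Integrable (fun x => Real.exp (t * h x)) μ := fun t =>
    integrable_exp_mul_of_mem_Icc hm.aemeasurable (.of_forall hIcc)
  have h1 : Integrable (fun x => Real.exp (h x)) μ := by simpa using hi 1
  refine tilted_of_cgf_le hm h1 (hi a) ?_
  -- Hoeffding is applied under the tilted law: under `μ`, together with Jensen, it would only give
  -- `a²b²/2`.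
  set p := μ.tilted h
  have : IsProbabilityMeasure p := isProbabilityMeasure_tilted h1
  have hp : ∀ t, Integrable (fun x => Real.exp (t * h x)) p := fun t =>
    integrable_exp_mul_of_mem_Icc hm.aemeasurable (.of_forall hIcc)
  have hcgf : ∀ t, cgf h p t = cgf h μ (t + 1) - cgf h μ 1 := fun t => by
    have e : mgf h p t = mgf h μ (t + 1) / mgf h μ 1 := by
      simp only [mgf, p]
      rw [integral_exp_tilted]
      simp [add_mul, add_comm]
    rw [cgf, e, Real.log_div (mgf_pos (hi _)).ne' (mgf_pos (hi _)).ne']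
    rfl
  have hbb : (((‖b - -b‖₊ / 2) ^ 2 : ℝ≥0) : ℝ) = b ^ 2 := by
    simp [← two_mul]
  have hsub : ∀ t, cgf h p t ≤ t * ∫ x, h x ∂p + b ^ 2 * t ^ 2 / 2 := fun t => by
    have := (hasSubgaussianMGF_of_mem_Icc (μ := p) hm.aemeasurable (.of_forall hIcc)).mgf_le t
    have hshift : mgf h p t = mgf (fun x => h x - ∫ y, h y ∂p) p t *
        Real.exp (t * ∫ x, h x ∂p) := by
      rw [mgf, mgf, ← integral_mul_const]
      congr with x
      rw [← Real.exp_add]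
      ring_nf
    have hpos : 0 < mgf h p t := mgf_pos (hp t)
    rw [cgf, Real.log_le_iff_le_exp hpos, hshift, add_comm, Real.exp_add]
    gcongr
    rwa [hbb] at this
  -- Adding `a - 1` times the bound at `-1` to the bound at `a - 1` cancels the mean and leaves
  -- `(a-1)²b²/2 + (a-1)b²/2 = a(a-1)b²/2`.
  have e1 := hsub (a - 1)
  have e2 := hsub (-1)
  have h0 : cgf h μ 0 = 0 := cgf_zero
  rw [hcgf] at e1 e2
  simp only [sub_add_cancel, neg_add_cancel, h0] at e1 e2
  nlinarith

/-- The Gaussian mechanism. -/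
lemma gaussianReal_gaussianReal (m m' : ℝ) {v : ℝ≥0} (hv : v ≠ 0) :
    HasRenyiBound a (ENNReal.ofReal (Real.exp (a * (a - 1) * (m - m') ^ 2 / (2 * v))))
      (gaussianReal m v) (gaussianReal m' v) := by
  have hv' : (v : ℝ) ≠ 0 := by exact_mod_cast hv
  -- With equal variances the quadratic terms of the log-likelihood ratio cancel; `r` is its linear
  -- part, and normalization absorbs the constant.
  set r : ℝ → ℝ := fun x => (m - m') / v * x
  have hr : ∀ t, (fun x => Real.exp (t * r x)) = fun x => Real.exp (t * ((m - m') / v) * x) :=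
    fun t => by ext x; simp only [r]; ring_nf
  have hi : ∀ t, Integrable (fun x => Real.exp (t * r x)) (gaussianReal m' v) :=
    fun t => by rw [hr]; exact integrable_exp_mul_gaussianReal _
  have hc : ∀ t, cgf r (gaussianReal m' v) t =
      m' * (t * ((m - m') / v)) + v * (t * ((m - m') / v)) ^ 2 / 2 := fun t => by
    have := cgf_gaussianReal (p := gaussianReal m' v) (X := id) Measure.map_id
      (t * ((m - m') / v))
    rw [← this, cgf, cgf, mgf, mgf, hr]
    rfl
  have htilt : gaussianReal m v = (gaussianReal m' v).tilted r := by
    have hz : ∫ x, Real.exp (r x) ∂(gaussianReal m' v) =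
        Real.exp (m' * ((m - m') / v) + v * ((m - m') / v) ^ 2 / 2) := by
      have := exp_cgf (hi 1)
      rw [hc] at this
      simpa [mgf] using this.symm
    rw [Measure.tilted, hz, gaussianReal_of_var_ne_zero _ hv, gaussianReal_of_var_ne_zero _ hv,
      ← withDensity_mul _ (measurable_gaussianPDF _ _) (by fun_prop)]
    congr with x
    rw [Pi.mul_apply, gaussianPDF, gaussianPDF, ← ENNReal.ofReal_mul (gaussianPDFReal_nonneg _ _ _),
      gaussianPDFReal, gaussianPDFReal, ← Real.exp_sub, mul_assoc _ (Real.exp _), ← Real.exp_add]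
    congr 3
    simp only [r]
    field_simp
    ring
  rw [htilt]
  refine tilted_of_cgf_le (by fun_prop) (by simpa using hi 1) (hi a) ?_
  rw [hc, hc]
  apply le_of_eq
  field_simp
  ring

end HasRenyiBound

/-! ### Sensitivity of linear queries -/

section Sensitivity

variable {X : Type*} [Fintype X] [DecidableEq X] {n : ℕ}

lemma answer_freq (φ : X → Bool) (P : Fin n → X) :
    answer φ (freq P) = (∑ i, if φ (P i) then (1 : ℝ) else 0) / n := by
  have h : ∀ x, (if φ x then (1 : ℝ) else 0) * freq P x =
      (∑ i, if P i = x then (if φ (P i) then (1 : ℝ) else 0) else 0) / n := fun x => by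
    rw [freq, ← mul_div_assoc, Finset.card_filter, Nat.cast_sum, Finset.mul_sum]
    congr 1
    refine Finset.sum_congr rfl fun i _ => ?_
    split_ifs <;> simp_all
  simp_rw [answer, h]
  rw [← Finset.sum_div, Finset.sum_comm]
  simp

lemma Neighboring.abs_answer_sub_le {P P' : Fin n → X} (h : Neighboring P P') (φ : X → Bool) :
    |answer φ (freq P) - answer φ (freq P')| ≤ 1 / n := by
  obtain ⟨i, hi⟩ := h
  rw [answer_freq, answer_freq, ← sub_div, ← Finset.sum_sub_distrib,
    Finset.sum_eq_single i (fun j _ hj => by rw [hi j hj, sub_self]) (by simp), abs_div,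
    Nat.abs_cast]
  gcongr
  split_ifs <;> simp

end Sensitivity

/-! ### Moment bounds for one round -/

section Primitives

variable {X : Type*} [Fintype X] {Q : Finset (X → Bool)} {a d s : ℝ} {p p' : X → ℝ}

/-- As a tilt, the change of dataset is seen only through the score difference, with no separate
estimate of the normalizing constants. -/
lemma expMech_eq_tilted (s : ℝ) (p p' D : X → ℝ) :
    expMech Q s p D = (expMech Q s p' D).tilted fun q =>
      s * (|answer q.1 p - answer q.1 D| - |answer q.1 p' - answer q.1 D|) := by
  rw [expMech, expMech, tilted_tilted .of_finite]
  congr with q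
  simp only [Pi.add_apply]
  ring

lemma hasRenyiBound_expMech [Nonempty Q] (ha : 1 < a) (hs : 0 ≤ s)
    (hd : ∀ q ∈ Q, |answer q p - answer q p'| ≤ d) (D : X → ℝ) :
    HasRenyiBound a (ENNReal.ofReal (Real.exp (a * (a - 1) * (s * d) ^ 2 / 2)))
      (expMech Q s p D) (expMech Q s p' D) := by
  rw [expMech_eq_tilted s p p' D]
  refine .tilted_of_abs_le (.of_discrete) (fun q => ?_) ha
  rw [abs_mul, abs_of_nonneg hs]
  gcongr
  refine (abs_abs_sub_abs_le_abs_sub _ _).trans ?_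
  simpa using hd q.1 q.2

lemma hasRenyiBound_selectKernel [Nonempty Q] (k : ℕ) (ha : 1 < a) (hs : 0 ≤ s)
    (hd : ∀ q ∈ Q, |answer q p - answer q p'| ≤ d) :
    Kernel.HasRenyiBound a (ENNReal.ofReal (Real.exp (a * (a - 1) * (s * d) ^ 2 / 2)) ^ k)
      (selectKernel Q k s p) (selectKernel Q k s p') := by
  refine .of_countable_right fun D => ?_
  have := HasRenyiBound.pi (ι := Fin k) (by linarith : 0 ≤ a)
    fun _ => hasRenyiBound_expMech ha hs hd D.1
  rw [Finset.prod_const, Finset.card_univ, Fintype.card_fin] at this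
  exact this

lemma hasRenyiBound_measureKernel (k : ℕ) (ha : 1 < a) {v : ℝ≥0} (hv : v ≠ 0)
    (hd : ∀ q ∈ Q, |answer q p - answer q p'| ≤ d) :
    Kernel.HasRenyiBound a (ENNReal.ofReal (Real.exp (a * (a - 1) * d ^ 2 / (2 * v))) ^ k)
      (measureKernel Q k v p) (measureKernel Q k v p') := by
  refine .of_countable_left fun q => ?_
  have := HasRenyiBound.pi (ι := Fin k) (by linarith : 0 ≤ a)
    fun i => (HasRenyiBound.gaussianReal_gaussianReal (a := a) (answer (q i).1 p)
      (answer (q i).1 p') hv).mono (c' := ENNReal.ofReal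
        (Real.exp (a * (a - 1) * d ^ 2 / (2 * v)))) (by
      have h1 : 0 ≤ a * (a - 1) := mul_nonneg (by linarith) (by linarith)
      have h2 := sq_le_sq' (abs_le.1 (hd _ (q i).2)).1 (abs_le.1 (hd _ (q i).2)).2
      gcongr)
  rw [Finset.prod_const, Finset.card_univ, Fintype.card_fin] at this
  exact this

lemma hasRenyiBound_roundKernel [Nonempty Q] (k : ℕ) (ha : 1 < a) (hs : 0 ≤ s) {v : ℝ≥0}
    (hv : v ≠ 0)
    (hd : ∀ q ∈ Q, |answer q p - answer q p'| ≤ d) :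
    Kernel.HasRenyiBound a
      (ENNReal.ofReal (Real.exp (k * (a * (a - 1) * ((s * d) ^ 2 / 2 + d ^ 2 / (2 * v))))))
      (roundKernel Q k s v p) (roundKernel Q k s v p') := by
  have := (hasRenyiBound_selectKernel k ha hs hd).compProd_prodMkLeft (by linarith)
    (hasRenyiBound_measureKernel k ha hv hd)
  rw [← mul_pow, ← ENNReal.ofReal_mul (Real.exp_pos _).le, ← Real.exp_add,
    ← ENNReal.ofReal_pow (Real.exp_pos _).le, ← Real.exp_nat_mul] at this
  rw [roundKernel, roundKernel]
  convert this using 5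
  ring

end Primitives

/-! ### Induction over rounds and the privacy budget -/

namespace AdaptiveMeasurements

variable {X : Type*} [Fintype X] {Q : Finset (X → Bool)} [Nonempty Q] {k : ℕ} {a d s : ℝ}

/-- The whole history is bounded, not just the iterates: given it, the next round is a kernel and
the update a data-independent map. -/
lemma hasRenyiBound_stateLaw (A : AdaptiveMeasurements X Q k) {p p' : X → ℝ} (ha : 1 < a)
    (hs : 0 ≤ s) {v : ℝ≥0} (hv : v ≠ 0) (hd : ∀ q ∈ Q, |answer q p - answer q p'| ≤ d) (t : ℕ) :
    HasRenyiBound a (ENNReal.ofReal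
      (Real.exp (k * (a * (a - 1) * ((s * d) ^ 2 / 2 + d ^ 2 / (2 * v))))) ^ t)
      (A.stateLaw s v p t) (A.stateLaw s v p' t) := by
  induction t with
  | zero =>
    rw [stateLaw, stateLaw, pow_zero]
    exact .refl a _
  | succ t ih =>
    rw [stateLaw, stateLaw, pow_succ]
    exact (((hasRenyiBound_roundKernel k ha hs hv hd).comap _).measure_compProd
      (by linarith) ih).map ha (A.measurable_extend t)

lemma hasRenyiBound_mechanism [DecidableEq X] {R : Type*} [MeasurableSpace R]
    (A : AdaptiveMeasurements X Q k) {n T : ℕ} (hn : 1 ≤ n) (hk : 1 ≤ k) (hT : 1 ≤ T) {ρ α : ℝ}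
    (hρ : 0 < ρ) (hα : α ∈ Set.Ioo (0 : ℝ) 1) {H : (Fin (T + 1) → stdSimplex ℝ X) → R}
    (hH : Measurable H) {P P' : Fin n → X} (hP : Neighboring P P') (ha : 1 < a) :
    HasRenyiBound a (ENNReal.ofReal (Real.exp ((a - 1) * (ρ * a))))
      (A.mechanism n T ρ α H hH P : Measure R) (A.mechanism n T ρ α H hH P' : Measure R) := by
  obtain ⟨hα0, hα1⟩ := hα
  have hn' : (0 : ℝ) < n := by exact_mod_cast hn
  have hk' : (0 : ℝ) < k := by exact_mod_cast hk
  have hT' : (0 : ℝ) < T := by exact_mod_cast hT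
  have hα2 : 0 < 1 - α := by linarith
  have hsq : eps0 ρ T k α ^ 2 = 2 * ρ / (k * T * (α ^ 2 + (1 - α) ^ 2)) :=
    Real.sq_sqrt (by positivity)
  have he : 0 < eps0 ρ T k α := Real.sqrt_pos.2 (by positivity)
  set e := eps0 ρ T k α
  have hvpos : 0 < (1 / (n * (1 - α) * e)) ^ 2 := by positivity
  have hb := (A.hasRenyiBound_stateLaw ha (s := α * e * n) (by positivity)
    (Real.toNNReal_pos.2 hvpos).ne' (fun q _ => hP.abs_answer_sub_le q) T).map ha
      (hH.comp measurable_fst)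
  rw [← ENNReal.ofReal_pow (Real.exp_pos _).le, ← Real.exp_nat_mul, Real.coe_toNNReal _ hvpos.le]
    at hb
  -- The sensitivity `1/n` cancels the factors `n` in the score coefficient and the noise scale.
  have hexp : (T : ℝ) * (k * (a * (a - 1) * ((α * e * n * (1 / n)) ^ 2 / 2 +
      (1 / n) ^ 2 / (2 * (1 / (n * (1 - α) * e)) ^ 2)))) = (a - 1) * (ρ * a) := by
    have : (T : ℝ) * (k * (a * (a - 1) * ((α * e * n * (1 / n)) ^ 2 / 2 +
      (1 / n) ^ 2 / (2 * (1 / (n * (1 - α) * e)) ^ 2)))) =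
        T * (k * (a * (a - 1) * (e ^ 2 * (α ^ 2 + (1 - α) ^ 2) / 2))) := by
      field_simp
    rw [this, hsq]
    field_simp
  rw [hexp] at hb
  exact hb

end AdaptiveMeasurements

theorem theorem1 {X R : Type*} [Fintype X] [DecidableEq X] [MeasurableSpace R]
    (Q : Finset (X → Bool)) [Nonempty Q] (n k T : ℕ) (hn : 1 ≤ n) (hk : 1 ≤ k) (hT : 1 ≤ T)
    (ρ α : ℝ) (hρ : 0 < ρ) (hα : α ∈ Set.Ioo (0 : ℝ) 1)
    (A : AdaptiveMeasurements X Q k)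
    (H : (Fin (T + 1) → stdSimplex ℝ X) → R) (hH : Measurable H) :
    IsZCDP ρ (A.mechanism n T ρ α H hH) ∧
    ∀ δ : ℝ, 0 < δ →
      IsDP (ρ + 2 * √(ρ * Real.log (1 / δ))) δ (A.mechanism n T ρ α H hH) :=
  ⟨fun _ _ hP _ ha =>
    (A.hasRenyiBound_mechanism hn hk hT hρ hα hH hP ha).renyiDivergence_le ha,
  fun _ hδ _ _ hP _ hS => measure_le_of_forall_hasRenyiBound hρ hδ
    (fun _ ha => A.hasRenyiBound_mechanism hn hk hT hρ hα hH hP ha) hS⟩
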